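/- Let $G$ be a topological group (a group with a topology for which multiplication and inversion are continuous), let $F$ be $\mathbb{R}$ or $\mathbb{C}$, let $C(G)$ be the space of continuous functions $G\to F$, and let $C_b(G)\subseteq C(G)$ be the space of bounded continuous functions with the supremum norm $\|\cdot\|_\infty$. For a function $g$ on $G$ and $s\in G$ put $(T_s g)(x)=g(sx)$ and $(T^s g)(x)=g(xs)$. A function $f\in C_b(G)$ is called *almost periodic* if both sets $\{T_s f : s\in G\}$ and $\{T^s f : s\in G\}$ are totally bounded in $C_b(G)$. A function $h\in C(G)$ is called *almost invariant* if both $A=\operatorname{span}\{T_s h : s\in G\}$ and $A'=\operatorname{span}\{T^s h : s\in G\}$ are finite-dimensional subspaces of $C(G)$. It is called *minimal almost invariant* if, moreover, every nonzero subspace of $A$ that is closed under all $T_s$ equals $A$, and every nonzero subspace of $A'$ that is closed under all $T^s$ equals $A'$. **Theorem (Bohr approximation theorem for general topological groups).** Every almost periodic function on $G$ can be uniformly approximated by almost periodic linear combinations of minimal almost invariant functions. That is, for every almost periodic $f\in C_b(G)$ and every $\varepsilon>0$ there is an almost periodic $p\in C_b(G)$ that is a finite $F$-linear combination of minimal almost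 invariant functions and satisfies $\|f-p\|_\infty<\varepsilon$. -/

import Mathlib

open scoped BoundedContinuousFunction

namespace AlmostPeriodic

section Translations

variable {G : Type*} [Group G] [TopologicalSpace G] [IsTopologicalGroup G]
variable {𝕜 : Type*} [RCLike 𝕜]

/-- The left translation `x ↦ s * x` as a continuous map. -/
def mulLeftMap (s : G) : C(G, G) := ⟨fun x => s * x, continuous_const.mul continuous_id⟩

/-- The right translation `x ↦ x * s` as a continuous map. -/
def mulRightMap (s : G) : C(G, G) := ⟨fun x => x * s, continuous_id.mul continuous_const⟩

/-- A bounded continuous function `f` is left almost periodic if the set of its left translates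
`x ↦ f (s * x)` is totally bounded for the supremum norm. -/
def IsLeftAlmostPeriodic (f : G →ᵇ 𝕜) : Prop :=
  TotallyBounded (Set.range fun s : G => f.compContinuous (mulLeftMap s))

/-- A bounded continuous function `f` is right almost periodic if the set of its right translates
`x ↦ f (x * s)` is totally bounded for the supremum norm. -/
def IsRightAlmostPeriodic (f : G →ᵇ 𝕜) : Prop :=
  TotallyBounded (Set.range fun s : G => f.compContinuous (mulRightMap s))

/-- Almost periodic: both left and right almost periodic. -/
def IsAlmostPeriodic (f : G →ᵇ 𝕜) : Prop :=
  IsLeftAlmostPeriodic f ∧ IsRightAlmostPeriodic f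

/-- The linear span in `C(G, 𝕜)` of the left translates of `f`. -/
def leftSpan (f : C(G, 𝕜)) : Submodule 𝕜 C(G, 𝕜) :=
  Submodule.span 𝕜 (Set.range fun s : G => f.comp (mulLeftMap s))

/-- The linear span in `C(G, 𝕜)` of the right translates of `f`. -/
def rightSpan (f : C(G, 𝕜)) : Submodule 𝕜 C(G, 𝕜) :=
  Submodule.span 𝕜 (Set.range fun s : G => f.comp (mulRightMap s))

/-- The subspace `W` is closed under all left translations. -/
def IsLeftInvariant (W : Submodule 𝕜 C(G, 𝕜)) : Prop :=
  ∀ s : G, ∀ g ∈ W, g.comp (mulLeftMap s) ∈ W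

/-- The subspace `W` is closed under all right translations. -/
def IsRightInvariant (W : Submodule 𝕜 C(G, 𝕜)) : Prop :=
  ∀ s : G, ∀ g ∈ W, g.comp (mulRightMap s) ∈ W

/-- Left almost invariant: the left translates span a finite-dimensional space. -/
def IsLeftAlmostInvariant (f : C(G, 𝕜)) : Prop := FiniteDimensional 𝕜 (leftSpan f)

/-- Right almost invariant: the right translates span a finite-dimensional space. -/
def IsRightAlmostInvariant (f : C(G, 𝕜)) : Prop := FiniteDimensional 𝕜 (rightSpan f)

/-- Almost invariant: both left and right almost invariant. -/
def IsAlmostInvariant (f : C(G, 𝕜)) : Prop :=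
  IsLeftAlmostInvariant f ∧ IsRightAlmostInvariant f

/-- Minimal almost invariant: almost invariant, and on either side the span of the translates has
no nonzero proper subspace that is closed under the translations of that side. -/
structure IsMinimalAlmostInvariant (f : C(G, 𝕜)) : Prop where
  almostInvariant : IsAlmostInvariant f
  left_minimal : ∀ W : Submodule 𝕜 C(G, 𝕜),
    W ≤ leftSpan f → W ≠ ⊥ → IsLeftInvariant W → W = leftSpan f
  right_minimal : ∀ W : Submodule 𝕜 C(G, 𝕜),
    W ≤ rightSpan f → W ≠ ⊥ → IsRightInvariant W → W = rightSpan f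

end Translations

end AlmostPeriodic

/-!
The theorem is reduced to harmonic analysis on a compact group. An almost periodic `f` defines the
bi-invariant pseudometric `d s t = sup_{x, y} |f (x s y) - f (x t y)|` on `G`. Almost periodicity
on both sides makes `d` totally bounded and continuous for the topology of `G`, so the completion
is a compact group `K`, with a continuous homomorphism `π : G → K` and a continuous `F` on `K` such
that `f = F ∘ π` (`IsAlmostPeriodic.exists_compactGroup`). Conversely, pullbacks along `π` are
almost periodic.

On `K`, the function `F` is uniformly close to `T F`, where `T : L²(K) → C(K)` is the convolution
with a bump function near `1`. The operator `T` commutes with left translations and is compact, so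
the eigenspaces of `A† A`, with `A : L² → L²` induced by `T`, span a dense subspace of `L²`; those
for nonzero eigenvalues are finite-dimensional and translation-invariant, and `T` vanishes on the
kernel, which is that of `A`. As `T` is continuous from `L²` to the supremum norm, `T F` is a
uniform limit of sums of functions from images `T E` of finite-dimensional invariant subspaces `E`
of `L²` (`mem_of_forall_finiteDimensional_invariant`). The spectral theorem is applied to a
self-adjoint operator and Schur's lemma is not used, so the argument is the same over `ℝ` and `ℂ`.

The `L²` inner product is invariant, so each such `E` is a sum of irreducible subspaces
(`map_le_span_isMinimalAlmostInvariant`), and every function in an irreducible finite-dimensional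
left-invariant space `W` of functions on `G` is minimal almost invariant
(`isMinimalAlmostInvariant_of_irreducible`): its right translates are matrix coefficients of `W`,
and they span a quotient of the dual of `W`, which is irreducible as well.
-/

namespace AlmostPeriodic

/-! ### Irreducible spaces of translates -/

section Dual

lemma eq_top_of_dualCoannihilator_eq_bot {K V : Type*} [Field K] [AddCommGroup V] [Module K V]
    [FiniteDimensional K V] {Λ : Submodule K (Module.Dual K V)} (h : Λ.dualCoannihilator = ⊥) :
    Λ = ⊤ := by
  rw [← Subspace.dualCoannihilator_dualAnnihilator_eq (W := Λ), h, Submodule.dualAnnihilator_bot]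

end Dual

section Minimal

variable {G : Type*} [Group G] [TopologicalSpace G] [IsTopologicalGroup G]
variable {𝕜 : Type*} [RCLike 𝕜]

lemma leftSpan_le {W : Submodule 𝕜 C(G, 𝕜)} (hW : IsLeftInvariant W) {h : C(G, 𝕜)} (hh : h ∈ W) :
    leftSpan h ≤ W :=
  Submodule.span_le.2 (Set.range_subset_iff.2 fun s => hW s h hh)

/-- Left translation by `s` as an endomorphism of a left-invariant space `W`. -/
def leftTranslation {W : Submodule 𝕜 C(G, 𝕜)} (hW : IsLeftInvariant W) (s : G) : W →ₗ[𝕜] W where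
  toFun w := ⟨(w : C(G, 𝕜)).comp (mulLeftMap s), hW s w w.2⟩
  map_add' _ _ := rfl
  map_smul' _ _ := rfl

lemma leftTranslation_leftTranslation {W : Submodule 𝕜 C(G, 𝕜)} (hW : IsLeftInvariant W)
    (s t : G) (w : W) :
    leftTranslation hW s (leftTranslation hW t w) = leftTranslation hW (t * s) w := by
  ext x
  simp [leftTranslation, mulLeftMap, mul_assoc]

/-- The matrix coefficient `x ↦ l (T_x h)` of a left-invariant space `W`, as a function of the
functional `l` on `W`. -/
def matrixCoeff {W : Submodule 𝕜 C(G, 𝕜)} (hW : IsLeftInvariant W) (h : W) :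
    Module.Dual 𝕜 W →ₗ[𝕜] (G → 𝕜) where
  toFun l x := l (leftTranslation hW x h)
  map_add' _ _ := rfl
  map_smul' _ _ := rfl

/-- The right translates of `h ∈ W` are matrix coefficients of `W`, because
`h (x * s) = (T_x h) s` and evaluation at `s` is a functional on `W`. -/
lemma rightSpan_le_range_matrixCoeff {W : Submodule 𝕜 C(G, 𝕜)} (hW : IsLeftInvariant W) (h : W) :
    (rightSpan (h : C(G, 𝕜))).map (ContinuousMap.coeFnLinearMap 𝕜) ≤
      LinearMap.range (matrixCoeff hW h) := by
  rw [rightSpan, Submodule.map_span_le]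
  rintro _ ⟨s, rfl⟩
  refine ⟨(LinearMap.proj s).comp ((ContinuousMap.coeFnLinearMap 𝕜).comp W.subtype), ?_⟩
  ext x
  rfl

/-- Elements of an irreducible finite-dimensional left-invariant space are minimal almost
invariant. On the right side, a right-invariant space `R` of matrix coefficients of `W` corresponds
to a space of functionals on `W` whose common kernel is left-invariant, hence `⊥` or all of `W`. -/
theorem isMinimalAlmostInvariant_of_irreducible {W : Submodule 𝕜 C(G, 𝕜)} [FiniteDimensional 𝕜 W]
    (hW : IsLeftInvariant W)
    (hirr : ∀ U : Submodule 𝕜 C(G, 𝕜), U ≤ W → U ≠ ⊥ → IsLeftInvariant U → U = W)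
    {h : C(G, 𝕜)} (hh : h ∈ W) : IsMinimalAlmostInvariant h := by
  have hle := leftSpan_le hW hh
  have hmc := rightSpan_le_range_matrixCoeff hW ⟨h, hh⟩
  have hinj : Function.Injective (ContinuousMap.coeFnLinearMap 𝕜 : C(G, 𝕜) →ₗ[𝕜] G → 𝕜) :=
    DFunLike.coe_injective
  refine ⟨⟨Submodule.finiteDimensional_of_le hle, ?_⟩, fun U hU hU0 hUi => ?_,
    fun R hR hR0 hRi => ?_⟩
  · have : Module.Finite 𝕜 (Module.Dual 𝕜 W) :=
      Subspace.instModuleDualFiniteDimensional (K := 𝕜) (V := W)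
    have : Module.Finite 𝕜 (LinearMap.range (matrixCoeff hW ⟨h, hh⟩)) := Module.Finite.range _
    have := Submodule.finiteDimensional_of_le hmc
    exact Module.Finite.equiv (Submodule.equivMapOfInjective _ hinj _).symm
  · exact le_antisymm hU (hle.trans (hirr U (hU.trans hle) hU0 hUi).ge)
  · -- the functionals whose matrix coefficient lies in `R`, and their common kernel
    let Λ : Submodule 𝕜 (Module.Dual 𝕜 W) :=
      (R.map (ContinuousMap.coeFnLinearMap 𝕜)).comap (matrixCoeff hW ⟨h, hh⟩)
    have hΛ : ∀ l ∈ Λ, ∀ s, l.comp (leftTranslation hW s) ∈ Λ := by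
      rintro l ⟨r, hr, hrl⟩ s
      refine ⟨r.comp (mulRightMap s), hRi s r hr, ?_⟩
      ext x
      have := congrFun hrl (x * s)
      simp only [matrixCoeff, LinearMap.coe_mk, AddHom.coe_mk, LinearMap.comp_apply,
        leftTranslation_leftTranslation] at this ⊢
      exact this
    have hN : IsLeftInvariant (Λ.dualCoannihilator.map W.subtype) := by
      rintro s _ ⟨w, hw, rfl⟩
      refine ⟨leftTranslation hW s w, ?_, rfl⟩
      rw [SetLike.mem_coe, Submodule.mem_dualCoannihilator] at hw ⊢
      exact fun l hl => hw _ (hΛ l hl s)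
    have key : Λ.dualCoannihilator = ⊥ := by
      by_contra hne
      have htop := hirr _ (Submodule.map_subtype_le W _)
        (fun h0 => hne
          (Submodule.map_injective_of_injective W.subtype_injective
            (h0.trans (Submodule.map_bot _).symm))) hN
      apply hR0
      rw [eq_bot_iff]
      intro r hr
      obtain ⟨l, hl⟩ := hmc (Submodule.mem_map_of_mem (hR hr))
      have hl0 : l = 0 := by
        ext w
        obtain ⟨w', hw', hww⟩ := htop.ge w.2
        obtain rfl : w' = w := Subtype.ext hww
        exact (Submodule.mem_dualCoannihilator _).1 hw' l ⟨r, hr, hl.symm⟩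
      rw [hl0, map_zero] at hl
      exact hinj (hl.symm.trans (map_zero _).symm)
    have hΛtop : Λ = ⊤ := eq_top_of_dualCoannihilator_eq_bot (K := 𝕜) (V := W) key
    refine le_antisymm hR fun r hr => ?_
    obtain ⟨l, hl⟩ := hmc (Submodule.mem_map_of_mem hr)
    obtain ⟨r', hr', hrl⟩ : l ∈ Λ := hΛtop ▸ Submodule.mem_top
    rwa [← hinj (hrl.trans hl)]

/-- Let `Θ` intertwine isometries `U s` of an inner product space with the left translations of
`C(G, 𝕜)`. Then `Θ` maps every finite-dimensional invariant subspace into the span of the minimal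
almost invariant functions. -/
theorem map_le_span_isMinimalAlmostInvariant {H : Type*} [NormedAddCommGroup H]
    [InnerProductSpace 𝕜 H] (U : G → H →ₗᵢ[𝕜] H) (Θ : H →ₗ[𝕜] C(G, 𝕜))
    (hΘ : ∀ s v, Θ (U s v) = (Θ v).comp (mulLeftMap s)) (E : Submodule 𝕜 H)
    [FiniteDimensional 𝕜 E] (hE : ∀ s, ∀ v ∈ E, U s v ∈ E) :
    E.map Θ ≤ Submodule.span 𝕜 {h : C(G, 𝕜) | IsMinimalAlmostInvariant h} := by
  induction hn : Module.finrank 𝕜 E using Nat.strong_induction_on generalizing E with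
  | _ n ih =>
  subst hn
  by_cases hirr : ∀ D : Submodule 𝕜 H, D ≤ E → D ≠ ⊥ → (∀ s, ∀ v ∈ D, U s v ∈ D) → D = E
  · -- an irreducible `E` has an irreducible image
    have hinv : IsLeftInvariant (E.map Θ) := by
      rintro s _ ⟨v, hv, rfl⟩
      exact ⟨U s v, hE s v hv, hΘ s v⟩
    rintro _ ⟨v, hv, rfl⟩
    refine Submodule.subset_span (isMinimalAlmostInvariant_of_irreducible hinv
      (fun V hV hV0 hVi => ?_) ⟨v, hv, rfl⟩)
    have hD : E ⊓ V.comap Θ = E := by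
      refine hirr _ inf_le_left (fun h0 => hV0 ?_) fun s v hv => ⟨hE s v hv.1, ?_⟩
      · rw [eq_bot_iff]
        intro g hg
        obtain ⟨w, hw, rfl⟩ := hV hg
        have : w ∈ E ⊓ V.comap Θ := ⟨hw, hg⟩
        rw [h0, Submodule.mem_bot] at this
        simp [this]
      · rw [SetLike.mem_coe, Submodule.mem_comap, hΘ]
        exact hVi s _ hv.2
    exact le_antisymm hV (Submodule.map_le_iff_le_comap.2 (inf_eq_left.1 hD))
  · push Not at hirr
    obtain ⟨D, hDE, hD0, hDi, hne⟩ := hirr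
    have : FiniteDimensional 𝕜 D := Submodule.finiteDimensional_of_le hDE
    have hlt : D < E := lt_of_le_of_ne hDE hne
    have h1 := ih _ (Submodule.finrank_lt_finrank_of_lt hlt) D hDi rfl
    have hE' : Dᗮ ⊓ E < E := by
      refine lt_of_le_of_ne inf_le_right fun h => hD0 ?_
      rw [eq_bot_iff, ← D.inf_orthogonal_eq_bot]
      exact le_inf le_rfl (hDE.trans (inf_eq_right.1 h))
    have hinv : ∀ s, ∀ v ∈ Dᗮ ⊓ E, U s v ∈ Dᗮ ⊓ E := by
      rintro s v ⟨hv, hvE⟩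
      refine ⟨(Submodule.mem_orthogonal _ _).2 fun w hw => ?_, hE s v hvE⟩
      -- `U s` is injective, hence surjective, on the finite-dimensional space `D`
      have hsurj : Function.Surjective ((U s).toLinearMap.restrict (hDi s)) :=
        LinearMap.injective_iff_surjective.1 fun a b hab =>
          Subtype.ext ((U s).injective (congrArg Subtype.val hab))
      obtain ⟨w', hw'⟩ := hsurj ⟨w, hw⟩
      have hw'' : U s w' = w := congrArg Subtype.val hw'
      rw [← hw'', LinearIsometry.inner_map_map]
      exact hv w' w'.2
    have h2 := ih _ (Submodule.finrank_lt_finrank_of_lt hE') (Dᗮ ⊓ E) hinv rfl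
    rw [← Submodule.sup_orthogonal_inf_of_hasOrthogonalProjection hDE, Submodule.map_sup]
    exact sup_le h1 h2

end Minimal

/-! ### Approximation on compact groups -/

section KernelOperator

variable {𝕜 : Type*} [RCLike 𝕜] {X : Type*} [TopologicalSpace X] [CompactSpace X]
variable {H : Type*} [NormedAddCommGroup H] [InnerProductSpace 𝕜 H]

/-- The operator `v ↦ (x ↦ ⟪κ x, v⟫)` from `H` to `C(X, 𝕜)` given by a continuous family `κ` of
vectors. -/
noncomputable def kernelOperator (κ : C(X, H)) : H →L[𝕜] C(X, 𝕜) :=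
  LinearMap.mkContinuous
    { toFun := fun v => ⟨fun x => inner 𝕜 (κ x) v, by fun_prop⟩
      map_add' := fun v w => by ext x; exact inner_add_right _ _ _
      map_smul' := fun c v => by ext x; exact inner_smul_right _ _ _ }
    ‖κ‖ fun v => (ContinuousMap.norm_le _ (by positivity)).2 fun x =>
      (norm_inner_le_norm _ _).trans (by gcongr; exact κ.norm_coe_le_norm x)

/-- A kernel operator is compact by the Arzelà–Ascoli theorem: the modulus of continuity of `κ`
bounds that of every function in the image of the unit ball. -/
lemma isCompactOperator_kernelOperator (κ : C(X, H)) :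
    IsCompactOperator (kernelOperator (𝕜 := 𝕜) κ) := by
  let e := ContinuousMap.isometryEquivBoundedOfCompact X 𝕜
  let A : Set (X →ᵇ 𝕜) := (fun v => e (kernelOperator κ v)) '' Metric.closedBall 0 1
  have hA : IsCompact (closure A) := by
    refine BoundedContinuousFunction.arzela_ascoli (Metric.closedBall (0 : 𝕜) ‖κ‖)
      (isCompact_closedBall _ _) A ?_ ?_
    · rintro _ x ⟨v, hv, rfl⟩
      rw [mem_closedBall_zero_iff] at hv ⊢
      calc ‖(inner 𝕜 (κ x) v : 𝕜)‖ ≤ ‖κ x‖ * ‖v‖ := norm_inner_le_norm _ _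
        _ ≤ ‖κ‖ * 1 := by gcongr; exact κ.norm_coe_le_norm x
        _ = ‖κ‖ := mul_one _
    · intro x
      refine Metric.equicontinuousAt_of_continuity_modulus (fun y => dist (κ x) (κ y)) ?_ _ ?_
      · have : Continuous fun y => dist (κ x) (κ y) := by fun_prop
        simpa using this.tendsto x
      · refine Filter.Eventually.of_forall ?_
        rintro y ⟨_, v, hv, rfl⟩
        rw [mem_closedBall_zero_iff] at hv
        calc dist (inner 𝕜 (κ x) v : 𝕜) (inner 𝕜 (κ y) v) = ‖(inner 𝕜 (κ x - κ y) v : 𝕜)‖ := by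
              rw [dist_eq_norm, inner_sub_left]
          _ ≤ ‖κ x - κ y‖ * ‖v‖ := norm_inner_le_norm _ _
          _ ≤ dist (κ x) (κ y) := by
              rw [dist_eq_norm]
              exact mul_le_of_le_one_right (norm_nonneg _) hv
  refine ⟨e.symm '' closure A, hA.image e.symm.continuous,
    Filter.mem_of_superset (Metric.closedBall_mem_nhds 0 one_pos) fun v hv => ?_⟩
  exact ⟨_, subset_closure ⟨v, hv, rfl⟩, e.symm_apply_apply _⟩

end KernelOperator

section SpectralApproximation

variable {𝕜 : Type*} [RCLike 𝕜] {H : Type*} [NormedAddCommGroup H] [InnerProductSpace 𝕜 H]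
  [CompleteSpace H]

/-- Let a compact operator `A` on a Hilbert space commute with the unitaries `U s`. If a closed
subspace `C` contains the image under `T` of every finite-dimensional invariant subspace, and
`T` vanishes on the kernel of `A`, then `C` contains the range of `T`. The finite-dimensional
subspaces that matter are the eigenspaces of `A† A`. -/
theorem mem_of_forall_finiteDimensional_invariant {Y : Type*} [NormedAddCommGroup Y]
    [NormedSpace 𝕜 Y] {ι : Type*} (U : ι → H →ₗᵢ[𝕜] H) (hU : ∀ s, Function.Surjective (U s))
    {A : H →L[𝕜] H} (hA : IsCompactOperator A) (hAU : ∀ s v, A (U s v) = U s (A v))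
    (T : H →L[𝕜] Y) (hTA : ∀ v, A v = 0 → T v = 0) (C : Submodule 𝕜 Y)
    (hC : IsClosed (C : Set Y))
    (hfin : ∀ E : Submodule 𝕜 H, FiniteDimensional 𝕜 E → (∀ s, ∀ v ∈ E, U s v ∈ E) →
      ∀ v ∈ E, T v ∈ C) (v : H) : T v ∈ C := by
  let S : H →L[𝕜] H := (ContinuousLinearMap.adjoint A).comp A
  have hSv : ∀ v w, inner 𝕜 (S v) w = inner 𝕜 (A v) (A w) := fun v w =>
    ContinuousLinearMap.adjoint_inner_left A w (A v)
  have hS : IsCompactOperator S := hA.clm_comp (ContinuousLinearMap.adjoint A)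
  have hSsymm : S.IsSymmetric := fun v w => by
    change (inner 𝕜 (S v) w : 𝕜) = inner 𝕜 v (S w)
    rw [hSv, ← inner_conj_symm v, hSv, inner_conj_symm]
  have hSU : ∀ s v, S (U s v) = U s (S v) := fun s v => by
    refine ext_inner_right 𝕜 fun w => ?_
    obtain ⟨w, rfl⟩ := hU s w
    rw [hSv, hAU, hAU, LinearIsometry.inner_map_map, LinearIsometry.inner_map_map, hSv]
  have hdense : (⨆ μ, Module.End.eigenspace (S : Module.End 𝕜 H) μ).topologicalClosure = ⊤ := by
    rw [Submodule.topologicalClosure_eq_top_iff]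
    exact ContinuousLinearMap.orthogonalComplement_iSup_eigenspaces_eq_bot hS hSsymm
  have hclosed : IsClosed ((C.comap T.toLinearMap : Submodule 𝕜 H) : Set H) :=
    hC.preimage T.continuous
  have hle : (⨆ μ, Module.End.eigenspace (S : Module.End 𝕜 H) μ) ≤ C.comap T.toLinearMap := by
    refine iSup_le fun μ w hw => ?_
    rcases eq_or_ne μ 0 with rfl | hμ
    · -- `⟪S w, w⟫ = ‖A w‖²`, so that the kernel of `S` is that of `A`
      have hSw : S w = 0 := by simpa using Module.End.mem_eigenspace_iff.1 hw
      have hAw : A w = 0 := by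
        rw [← inner_self_eq_zero (𝕜 := 𝕜), ← hSv, hSw, inner_zero_left]
      rw [Submodule.mem_comap]
      simp [hTA w hAw]
    · refine hfin _ (ContinuousLinearMap.finite_dimensional_eigenspace hS μ hμ)
        (fun s x hx => ?_) w hw
      rw [Module.End.mem_eigenspace_iff] at hx ⊢
      change S (U s x) = _
      rw [hSU, show S x = μ • x from hx, map_smul]
  exact Submodule.topologicalClosure_minimal _ hle hclosed (hdense ▸ Submodule.mem_top)

end SpectralApproximation

section Translation

open MeasureTheory

variable {𝕜 : Type*} [RCLike 𝕜] {K : Type*} [Group K] [TopologicalSpace K] [IsTopologicalGroup K]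
  [MeasurableSpace K] [BorelSpace K] (μ : Measure K) [μ.IsHaarMeasure]

/-- Left translation by `s` as an isometry of `L²`. -/
noncomputable def l2Translation (𝕜 : Type*) [RCLike 𝕜] (s : K) : Lp 𝕜 2 μ →ₗᵢ[𝕜] Lp 𝕜 2 μ :=
  Lp.compMeasurePreservingₗᵢ 𝕜 (fun x => s * x) (measurePreserving_mul_left μ s)

lemma l2Translation_surjective (s : K) : Function.Surjective (l2Translation μ 𝕜 s) := by
  intro g
  refine ⟨l2Translation μ 𝕜 s⁻¹ g, ?_⟩
  change Lp.compMeasurePreserving _ (measurePreserving_mul_left μ s)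
    (Lp.compMeasurePreserving _ (measurePreserving_mul_left μ s⁻¹) g) = g
  rw [← Lp.compMeasurePreserving_comp_apply]
  convert Lp.compMeasurePreserving_id_apply g using 3
  ext x
  simp

end Translation

section CompactGroup

open MeasureTheory

variable {𝕜 : Type*} [RCLike 𝕜] {K : Type*} [Group K] [TopologicalSpace K] [IsTopologicalGroup K]
  [CompactSpace K]

/-- The continuous family `x ↦ ψ (x⁻¹ · )` of left translates of `ψ`. -/
def translateFamily (ψ : C(K, 𝕜)) : C(K, C(K, 𝕜)) :=
  ContinuousMap.curry ⟨fun z : K × K => ψ (z.1⁻¹ * z.2), by fun_prop⟩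

/-- The right oscillation `u ↦ sup_x |F (x u) - F x|` of `F`, as a continuous function. -/
noncomputable def rightOscillation (F : C(K, 𝕜)) : C(K, ℝ) :=
  ⟨fun u => ‖ContinuousMap.curry ⟨fun z : K × K => F (z.2 * z.1), by fun_prop⟩ u - F‖, by fun_prop⟩

lemma norm_sub_le_rightOscillation (F : C(K, 𝕜)) (u x : K) :
    ‖F (x * u) - F x‖ ≤ rightOscillation F u :=
  ContinuousMap.norm_coe_le_norm
    (ContinuousMap.curry ⟨fun z : K × K => F (z.2 * z.1), by fun_prop⟩ u - F) x

lemma rightOscillation_one (F : C(K, 𝕜)) : rightOscillation F 1 = 0 := by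
  have : ContinuousMap.curry ⟨fun z : K × K => F (z.2 * z.1), by fun_prop⟩ 1 = F := by
    ext x; simp
  simp [rightOscillation, this]

variable [MeasurableSpace K] [BorelSpace K] (μ : Measure K) [μ.IsHaarMeasure]

lemma l2Translation_toLp (s : K) (g : C(K, 𝕜)) :
    l2Translation μ 𝕜 s (ContinuousMap.toLp 2 μ 𝕜 g) =
      ContinuousMap.toLp 2 μ 𝕜 (g.comp (mulLeftMap s)) := by
  exact Lp.toLp_compMeasurePreserving (g.memLp μ 𝕜) (measurePreserving_mul_left μ s)

/-- The convolution-type operator `g ↦ (x ↦ ∫ conj (ψ (x⁻¹ y)) g y dy)` from `L²` to `C(K, 𝕜)`. -/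
noncomputable def convOperator (ψ : C(K, 𝕜)) : Lp 𝕜 2 μ →L[𝕜] C(K, 𝕜) :=
  kernelOperator ⟨fun x => ContinuousMap.toLp 2 μ 𝕜 (translateFamily ψ x), by fun_prop⟩

lemma convOperator_l2Translation (ψ : C(K, 𝕜)) (s : K) (g : Lp 𝕜 2 μ) :
    convOperator μ ψ (l2Translation μ 𝕜 s g) = (convOperator μ ψ g).comp (mulLeftMap s) := by
  ext x
  have h : ContinuousMap.toLp 2 μ 𝕜 (translateFamily ψ x) =
      l2Translation μ 𝕜 s (ContinuousMap.toLp 2 μ 𝕜 (translateFamily ψ (s * x))) := by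
    rw [l2Translation_toLp]
    congr 1
    ext y
    simp [translateFamily, mulLeftMap, mul_assoc]
  change inner 𝕜 (ContinuousMap.toLp 2 μ 𝕜 (translateFamily ψ x)) _ =
    inner 𝕜 (ContinuousMap.toLp 2 μ 𝕜 (translateFamily ψ (s * x))) g
  rw [h, LinearIsometry.inner_map_map]

lemma convOperator_toLp_apply (ψ F : C(K, 𝕜)) (x : K) :
    convOperator μ ψ (ContinuousMap.toLp 2 μ 𝕜 F) x =
      ∫ y, F y * (starRingEnd 𝕜) (ψ (x⁻¹ * y)) ∂μ :=
  ContinuousMap.inner_toLp μ _ _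

/-- A normalised bump function supported where the oscillation of `F` is at most `ε`. -/
lemma exists_bump_mul_rightOscillation_le (F : C(K, 𝕜)) {ε : ℝ} (hε : 0 < ε) :
    ∃ b : C(K, ℝ), (∀ u, 0 ≤ b u) ∧ ∫ u, b u ∂μ = 1 ∧
      ∀ u, rightOscillation F u * b u ≤ ε * b u := by
  let b : C(K, ℝ) := ⟨fun u => max 0 (ε - rightOscillation F u), by fun_prop⟩
  have hb0 : ∀ u, 0 ≤ b u := fun u => le_max_left _ _
  have hbosc : ∀ u, rightOscillation F u * b u ≤ ε * b u := fun u => by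
    rcases le_or_gt (rightOscillation F u) ε with h | h
    · exact mul_le_mul_of_nonneg_right h (hb0 u)
    · have : b u = 0 := max_eq_left (by linarith)
      simp [this]
  have hcpos : 0 < ∫ u, b u ∂μ := by
    refine Continuous.integral_pos_of_hasCompactSupport_nonneg_nonzero (x := 1) b.continuous
      (HasCompactSupport.of_compactSpace _) hb0 ?_
    simpa [b, rightOscillation_one] using hε
  set c : ℝ := ∫ u, b u ∂μ with hc
  refine ⟨c⁻¹ • b, fun u => mul_nonneg (inv_nonneg.2 hcpos.le) (hb0 u), ?_, fun u => ?_⟩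
  · change ∫ u, c⁻¹ * b u ∂μ = 1
    rw [integral_const_mul, ← hc, inv_mul_cancel₀ hcpos.ne']
  · change _ * (c⁻¹ * b u) ≤ _ * (c⁻¹ * b u)
    rw [mul_left_comm, mul_left_comm ε]
    exact mul_le_mul_of_nonneg_left (hbosc u) (inv_nonneg.2 hcpos.le)

/-- Convolution with a normalised bump function supported where the oscillation of `F` is at most
`ε` moves `F` by at most `ε`. -/
lemma exists_norm_sub_convOperator_le (F : C(K, 𝕜)) {ε : ℝ} (hε : 0 < ε) :
    ∃ ψ : C(K, 𝕜), ‖F - convOperator μ ψ (ContinuousMap.toLp 2 μ 𝕜 F)‖ ≤ ε := by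
  obtain ⟨b, hb0, hb1, hbosc⟩ := exists_bump_mul_rightOscillation_le μ F hε
  refine ⟨⟨fun u => (b u : 𝕜), by fun_prop⟩, (ContinuousMap.norm_le _ hε.le).2 fun x => ?_⟩
  have hb1x : ∫ y, b (x⁻¹ * y) ∂μ = 1 := by rw [integral_mul_left_eq_self b, hb1]
  have hi : ∀ g : C(K, 𝕜), Integrable (fun y => g y * (b (x⁻¹ * y) : 𝕜)) μ := fun g =>
    Continuous.integrable_of_hasCompactSupport (by fun_prop) (HasCompactSupport.of_compactSpace _)
  have hi' : Integrable (fun y => ε * b (x⁻¹ * y)) μ :=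
    Continuous.integrable_of_hasCompactSupport (by fun_prop) (HasCompactSupport.of_compactSpace _)
  have hx : Integrable (fun y => F x * (b (x⁻¹ * y) : 𝕜)) μ := hi (.const K (F x))
  have h1 : ∫ y, F x * (b (x⁻¹ * y) : 𝕜) ∂μ = F x := by
    rw [integral_const_mul, integral_ofReal, hb1x]
    simp
  have h2 : (F - convOperator μ ⟨fun u => (b u : 𝕜), by fun_prop⟩ (ContinuousMap.toLp 2 μ 𝕜 F)) x =
      ∫ y, (F x * (b (x⁻¹ * y) : 𝕜) - F y * (b (x⁻¹ * y) : 𝕜)) ∂μ := by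
    rw [integral_sub hx (hi F), h1, ContinuousMap.sub_apply, convOperator_toLp_apply]
    simp only [ContinuousMap.coe_mk, RCLike.conj_ofReal]
  have h3 : ∀ y, ‖F x * (b (x⁻¹ * y) : 𝕜) - F y * (b (x⁻¹ * y) : 𝕜)‖ ≤ ε * b (x⁻¹ * y) := by
    intro y
    have h := norm_sub_le_rightOscillation F (x⁻¹ * y) x
    rw [mul_inv_cancel_left] at h
    rw [← sub_mul, norm_mul, RCLike.norm_ofReal, abs_of_nonneg (hb0 _), norm_sub_rev]
    exact (mul_le_mul_of_nonneg_right h (hb0 _)).trans (hbosc _)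
  rw [h2]
  refine (norm_integral_le_of_norm_le hi' (.of_forall h3)).trans_eq ?_
  rw [integral_const_mul, hb1x, mul_one]

end CompactGroup

section Approximation

open MeasureTheory

variable {𝕜 : Type*} [RCLike 𝕜] {K : Type*} [Group K] [TopologicalSpace K] [IsTopologicalGroup K]
  [CompactSpace K] {G : Type*} [Group G] [TopologicalSpace G] [IsTopologicalGroup G]

/-- A form of the Peter–Weyl theorem: continuous functions on a compact group `K` are uniform
limits of functions whose pullback along a given homomorphism `π : G → K` is a linear combination
of minimal almost invariant functions. -/
theorem exists_norm_sub_lt_comp_mem_span (π : G →ₜ* K) (F : C(K, 𝕜)) {ε : ℝ} (hε : 0 < ε) :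
    ∃ P : C(K, 𝕜), P.comp (π : C(G, K)) ∈
        Submodule.span 𝕜 {h : C(G, 𝕜) | IsMinimalAlmostInvariant h} ∧ ‖F - P‖ < ε := by
  borelize K
  let μ : Measure K := Measure.haar
  let pull : C(K, 𝕜) →ₗ[𝕜] C(G, 𝕜) :=
    { toFun := fun P => P.comp (π : C(G, K))
      map_add' := fun _ _ => rfl
      map_smul' := fun _ _ => rfl }
  let M : Submodule 𝕜 C(K, 𝕜) :=
    (Submodule.span 𝕜 {h : C(G, 𝕜) | IsMinimalAlmostInvariant h}).comap pull
  suffices hF : F ∈ closure (M : Set C(K, 𝕜)) by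
    obtain ⟨P, hP, hd⟩ := Metric.mem_closure_iff.1 hF ε hε
    exact ⟨P, hP, by rwa [← dist_eq_norm]⟩
  have hconv : ∀ (ψ : C(K, 𝕜)) (v : Lp 𝕜 2 μ), convOperator μ ψ v ∈ M.topologicalClosure := by
    intro ψ
    let J : C(K, 𝕜) →L[𝕜] Lp 𝕜 2 μ := ContinuousMap.toLp 2 μ 𝕜
    refine mem_of_forall_finiteDimensional_invariant (fun s : G => l2Translation μ 𝕜 (π s))
      (fun s => l2Translation_surjective μ (π s)) (A := J.comp (convOperator μ ψ))
      ((isCompactOperator_kernelOperator _).clm_comp J) ?_ _ ?_ _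
      M.isClosed_topologicalClosure ?_
    · intro s v
      simp only [J, ContinuousLinearMap.comp_apply, convOperator_l2Translation,
        l2Translation_toLp]
    · intro v hv
      exact ContinuousMap.toLp_injective μ (hv.trans (map_zero J).symm)
    · intro E hE hinv v hv
      refine M.le_topologicalClosure ?_
      refine map_le_span_isMinimalAlmostInvariant (fun s : G => l2Translation μ 𝕜 (π s))
        (pull ∘ₗ (convOperator μ ψ).toLinearMap) (fun s v => ?_) E hinv
        (Submodule.mem_map_of_mem hv)
      have := convOperator_l2Translation μ ψ (π s) v
      ext x
      simpa [pull, mulLeftMap] using congrArg (fun g : C(K, 𝕜) => g (π x)) this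
  rw [← closure_closure, Metric.mem_closure_iff]
  intro δ hδ
  obtain ⟨ψ, hψ⟩ := exists_norm_sub_convOperator_le μ F (half_pos hδ)
  exact ⟨_, hconv ψ _, by rw [dist_eq_norm]; linarith⟩

end Approximation

/-! ### The compact group of an almost periodic function -/

section BohrCompactification

variable {G : Type*} [Group G] [TopologicalSpace G] [IsTopologicalGroup G]
variable {𝕜 : Type*} [RCLike 𝕜]

/-- A totally bounded family is approximated within `ε` by finitely many of its members. -/
lemma exists_finset_forall_dist_lt {ι Y : Type*} [PseudoMetricSpace Y] {g : ι → Y}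
    (hg : TotallyBounded (Set.range g)) {ε : ℝ} (hε : 0 < ε) :
    ∃ A : Finset ι, ∀ s, ∃ a ∈ A, dist (g s) (g a) < ε := by
  obtain ⟨t, hts, htf, hcov⟩ := Metric.finite_approx_of_totallyBounded hg ε hε
  choose c hc using hts
  have := htf.fintype
  classical
  refine ⟨Finset.univ.image fun y : t => c y.2, fun s => ?_⟩
  obtain ⟨y, hy, hys⟩ := Set.mem_iUnion₂.1 (hcov ⟨s, rfl⟩)
  exact ⟨c hy, Finset.mem_image.2 ⟨⟨y, hy⟩, Finset.mem_univ _, rfl⟩, by rwa [hc hy]⟩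

/-- For an almost periodic `f`, the two-sided oscillation `sup_{x, y} |f (x s y) - f (x t y)|` is
controlled by finitely many pairs `(x, y)`. -/
lemma IsAlmostPeriodic.exists_finset_dist_le {f : G →ᵇ 𝕜} (hf : IsAlmostPeriodic f) {ε : ℝ}
    (hε : 0 < ε) : ∃ A B : Finset G, ∀ s t : G,
      (∀ a ∈ A, ∀ b ∈ B, dist (f (a * s * b)) (f (a * t * b)) ≤ ε) →
        ∀ x y, dist (f (x * s * y)) (f (x * t * y)) ≤ 5 * ε := by
  obtain ⟨A, hA⟩ := exists_finset_forall_dist_lt hf.1 hε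
  obtain ⟨B, hB⟩ := exists_finset_forall_dist_lt hf.2 hε
  refine ⟨A, B, fun s t hst x y => ?_⟩
  obtain ⟨a, ha, hxa⟩ := hA x
  obtain ⟨b, hb, hyb⟩ := hB y
  have h1 : ∀ z, dist (f (x * z)) (f (a * z)) ≤ ε := fun z =>
    (BoundedContinuousFunction.dist_coe_le_dist z).trans hxa.le
  have h2 : ∀ z, dist (f (z * y)) (f (z * b)) ≤ ε := fun z =>
    (BoundedContinuousFunction.dist_coe_le_dist z).trans hyb.le
  have h3 : ∀ z, dist (f (x * z * y)) (f (a * z * b)) ≤ 2 * ε := fun z => by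
    have := dist_triangle (f (x * z * y)) (f (x * z * b)) (f (a * z * b))
    have h4 := h1 (z * b)
    rw [← mul_assoc, ← mul_assoc] at h4
    linarith [h2 (x * z)]
  have h5 := dist_triangle4 (f (x * s * y)) (f (a * s * b)) (f (a * t * b)) (f (x * t * y))
  have h6 := h3 t
  rw [dist_comm] at h6
  linarith [h3 s, hst a ha b hb]

/-- The function `(x, y) ↦ f (x s y)`. -/
def twoSidedTranslate (f : G →ᵇ 𝕜) (s : G) : (G × G) →ᵇ 𝕜 :=
  f.compContinuous ⟨fun z => z.1 * s * z.2, by fun_prop⟩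

/-- The group `G`, written additively, with the bi-invariant pseudometric
`d s t = sup_{x, y} |f (x s y) - f (x t y)|`. The additive notation gives access to the group
structure on the completion, which Mathlib provides for additive groups. -/
def BohrSpace (_f : G →ᵇ 𝕜) : Type _ := Additive G

instance (f : G →ᵇ 𝕜) : AddGroup (BohrSpace f) := inferInstanceAs (AddGroup (Additive G))

noncomputable instance (f : G →ᵇ 𝕜) : PseudoMetricSpace (BohrSpace f) :=
  PseudoMetricSpace.induced (fun s : Additive G => twoSidedTranslate f s.toMul) inferInstance

/-- The point of `BohrSpace f` given by a group element. -/
def toBohrSpace (f : G →ᵇ 𝕜) (s : G) : BohrSpace f := Additive.ofMul s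

lemma dist_toBohrSpace_le {f : G →ᵇ 𝕜} {s t : G} {C : ℝ} (hC : 0 ≤ C) :
    dist (toBohrSpace f s) (toBohrSpace f t) ≤ C ↔
      ∀ x y, dist (f (x * s * y)) (f (x * t * y)) ≤ C :=
  (BoundedContinuousFunction.dist_le (f := twoSidedTranslate f s) (g := twoSidedTranslate f t)
    hC).trans Prod.forall

lemma dist_le_dist_toBohrSpace (f : G →ᵇ 𝕜) (s t x y : G) :
    dist (f (x * s * y)) (f (x * t * y)) ≤ dist (toBohrSpace f s) (toBohrSpace f t) :=
  (dist_toBohrSpace_le dist_nonneg).1 le_rfl x y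

lemma dist_toBohrSpace_div_le (f : G →ᵇ 𝕜) (s t s' t' : G) :
    dist (toBohrSpace f (s / t)) (toBohrSpace f (s' / t')) ≤
      dist (toBohrSpace f s) (toBohrSpace f s') + dist (toBohrSpace f t) (toBohrSpace f t') := by
  refine (dist_toBohrSpace_le (by positivity)).2 fun x y => ?_
  refine (dist_triangle _ (f (x * (s' / t) * y)) _).trans (add_le_add ?_ ?_)
  · have := dist_le_dist_toBohrSpace f s s' x (t⁻¹ * y)
    simpa only [div_eq_mul_inv, mul_assoc] using this
  · have := dist_le_dist_toBohrSpace f t t' (x * s' * t⁻¹) (t'⁻¹ * y)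
    rw [dist_comm]
    simpa [div_eq_mul_inv, mul_assoc] using this

instance (f : G →ᵇ 𝕜) : IsUniformAddGroup (BohrSpace f) := by
  refine ⟨Metric.uniformContinuous_iff.2 fun ε hε => ⟨ε / 2, half_pos hε, ?_⟩⟩
  rintro ⟨s, t⟩ ⟨s', t'⟩ h
  obtain ⟨h1, h2⟩ := max_lt_iff.1 (show max (dist s s') (dist t t') < ε / 2 from h)
  have key : dist (s - t) (s' - t') ≤ dist s s' + dist t t' :=
    dist_toBohrSpace_div_le f (Additive.toMul s) (Additive.toMul t) (Additive.toMul s')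
      (Additive.toMul t')
  change dist (s - t) (s' - t') < ε
  linarith

lemma IsAlmostPeriodic.totallyBounded_univ {f : G →ᵇ 𝕜} (hf : IsAlmostPeriodic f) :
    TotallyBounded (Set.univ : Set (BohrSpace f)) := by
  refine Metric.totallyBounded_iff.2 fun ε hε => ?_
  obtain ⟨A, B, hAB⟩ := hf.exists_finset_dist_le (show 0 < ε / 6 by positivity)
  let Ψ : G → (A × B → 𝕜) := fun s z => f (z.1 * s * z.2)
  have hΨ : TotallyBounded (Set.range Ψ) := by
    refine (isCompact_closedBall (0 : A × B → 𝕜) ‖f‖).totallyBounded.subset ?_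
    rintro _ ⟨s, rfl⟩
    exact mem_closedBall_zero_iff.2
      ((pi_norm_le_iff_of_nonneg (norm_nonneg f)).2 fun z => f.norm_coe_le_norm _)
  obtain ⟨N, hN⟩ := exists_finset_forall_dist_lt hΨ (show 0 < ε / 6 by positivity)
  refine ⟨toBohrSpace f '' N, N.finite_toSet.image _, fun s _ => ?_⟩
  obtain ⟨t, ht, hst⟩ := hN (Additive.toMul s)
  refine Set.mem_iUnion₂.2 ⟨_, ⟨t, ht, rfl⟩, ?_⟩
  have : dist (toBohrSpace f (Additive.toMul s)) (toBohrSpace f t) ≤ 5 * (ε / 6) :=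
    (dist_toBohrSpace_le (by positivity)).2 (hAB _ _ fun a ha b hb =>
      (dist_le_pi_dist (Ψ (Additive.toMul s)) (Ψ t) (⟨a, ha⟩, ⟨b, hb⟩)).trans hst.le)
  exact Metric.mem_ball.2 (this.trans_lt (by linarith))

lemma IsAlmostPeriodic.continuous_toBohrSpace {f : G →ᵇ 𝕜} (hf : IsAlmostPeriodic f) :
    Continuous (toBohrSpace f) := by
  refine Metric.continuous_iff'.2 fun s ε hε => ?_
  obtain ⟨A, B, hAB⟩ := hf.exists_finset_dist_le (show 0 < ε / 6 by positivity)
  have h : ∀ᶠ t in nhds s, ∀ a ∈ A, ∀ b ∈ B, dist (f (a * t * b)) (f (a * s * b)) < ε / 6 := by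
    simp only [Filter.eventually_all_finset]
    intro a _ b _
    have hc : Continuous fun t => f (a * t * b) := by fun_prop
    exact Metric.continuous_iff'.1 hc s _ (by positivity)
  filter_upwards [h] with t ht
  exact ((dist_toBohrSpace_le (by positivity)).2
    (hAB _ _ fun a ha b hb => (ht a ha b hb).le)).trans_lt (by linarith)

/-- Every almost periodic function factors through a continuous homomorphism to a compact group:
the completion of `G` for the pseudometric of `BohrSpace f`. -/
theorem IsAlmostPeriodic.exists_compactGroup.{u} {G : Type u} [Group G] [TopologicalSpace G]
    [IsTopologicalGroup G] {f : G →ᵇ 𝕜} (hf : IsAlmostPeriodic f) :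
    ∃ (K : Type u) (_ : Group K) (_ : TopologicalSpace K) (_ : IsTopologicalGroup K)
      (_ : CompactSpace K) (π : G →ₜ* K) (F : C(K, 𝕜)), ∀ s, F (π s) = f s := by
  let C := UniformSpace.Completion (BohrSpace f)
  have hcpt : CompactSpace C := by
    have h := hf.totallyBounded_univ.image
      (UniformSpace.Completion.uniformContinuous_coe (BohrSpace f))
    rw [Set.image_univ] at h
    refine ⟨?_⟩
    rw [← UniformSpace.Completion.denseRange_coe.closure_range]
    exact h.closure.isCompact_of_isClosed isClosed_closure
  let e : BohrSpace f → 𝕜 := fun s => f (Additive.toMul s)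
  have he : UniformContinuous e := by
    refine Metric.uniformContinuous_iff.2 fun ε hε => ⟨ε, hε, fun {s t} hst => ?_⟩
    have := dist_le_dist_toBohrSpace f (Additive.toMul s) (Additive.toMul t) 1 1
    rw [one_mul, mul_one, one_mul, mul_one] at this
    exact this.trans_lt hst
  let π : G →ₜ* Multiplicative C :=
    { toFun := fun s => Multiplicative.ofAdd (toBohrSpace f s : C)
      map_one' := rfl
      map_mul' := fun s t => congrArg Multiplicative.ofAdd
        (UniformSpace.Completion.coe_add (toBohrSpace f s) (toBohrSpace f t))
      continuous_toFun := continuous_ofAdd.comp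
        ((UniformSpace.Completion.continuous_coe _).comp hf.continuous_toBohrSpace) }
  refine ⟨Multiplicative C, inferInstance, inferInstance, inferInstance, inferInstance, π,
    ⟨fun k => UniformSpace.Completion.extension e (Multiplicative.toAdd k),
      UniformSpace.Completion.continuous_extension.comp continuous_toAdd⟩, fun s => ?_⟩
  exact UniformSpace.Completion.extension_coe he (toBohrSpace f s)

/-- Pullbacks of continuous functions on a compact group are almost periodic, since their
translates lie in a continuous image of the compact group. -/
theorem isAlmostPeriodic_compContinuous {K : Type*} [Group K] [TopologicalSpace K]
    [IsTopologicalGroup K] [CompactSpace K] (π : G →ₜ* K) (P : C(K, 𝕜)) :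
    IsAlmostPeriodic ((BoundedContinuousFunction.mkOfCompact P).compContinuous (π : C(G, K))) := by
  let pull : C(K, 𝕜) → (G →ᵇ 𝕜) := fun Q =>
    (BoundedContinuousFunction.mkOfCompact Q).compContinuous (π : C(G, K))
  have hpull : Continuous pull :=
    (BoundedContinuousFunction.continuous_compContinuous _).comp
      (ContinuousMap.isometryEquivBoundedOfCompact K 𝕜).continuous
  have htb : ∀ Φ : C(K, C(K, 𝕜)), TotallyBounded (Set.range fun k => pull (Φ k)) := fun Φ =>
    (isCompact_range (hpull.comp Φ.continuous)).totallyBounded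
  constructor
  · refine (htb (ContinuousMap.curry ⟨fun z => P (z.1 * z.2), by fun_prop⟩)).subset ?_
    rintro _ ⟨s, rfl⟩
    refine ⟨π s, ?_⟩
    ext x
    simp [pull, mulLeftMap]
  · refine (htb (ContinuousMap.curry ⟨fun z => P (z.2 * z.1), by fun_prop⟩)).subset ?_
    rintro _ ⟨s, rfl⟩
    refine ⟨π s, ?_⟩
    ext x
    simp [pull, mulRightMap]

end BohrCompactification

end AlmostPeriodic

theorem mainTheorem1 {𝕜 : Type*} [RCLike 𝕜]
    {G : Type*} [Group G] [TopologicalSpace G] [IsTopologicalGroup G]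
    (f : G →ᵇ 𝕜) (hf : AlmostPeriodic.IsAlmostPeriodic f) (ε : ℝ) (hε : 0 < ε) :
    ∃ p : G →ᵇ 𝕜,
      p.toContinuousMap ∈
        Submodule.span 𝕜 {h : C(G, 𝕜) | AlmostPeriodic.IsMinimalAlmostInvariant h} ∧
      AlmostPeriodic.IsAlmostPeriodic p ∧
      ‖f - p‖ < ε := by
  obtain ⟨K, _, _, _, _, π, F, hF⟩ := hf.exists_compactGroup
  obtain ⟨P, hP, hFP⟩ := AlmostPeriodic.exists_norm_sub_lt_comp_mem_span π F hε
  refine ⟨(BoundedContinuousFunction.mkOfCompact P).compContinuous (π : C(G, K)), hP,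
    AlmostPeriodic.isAlmostPeriodic_compContinuous π P, ?_⟩
  refine ((BoundedContinuousFunction.norm_le (norm_nonneg (F - P))).2 fun s => ?_).trans_lt hFP
  have := (F - P).norm_coe_le_norm (π s)
  rw [ContinuousMap.sub_apply, hF] at this
  exact this
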